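/- Let $\lambda^d$ denote Lebesgue measure on $\mathbb{R}^d$. Say that an element of a family $\mathcal{A}$ of Lebesgue measurable subsets of $\mathbb{R}^d$ of finite measure can be reconstructed using $n$ test sets if there exist measurable sets $T_1,\dots,T_n\subset\mathbb{R}^d$ such that whenever $A,B\in\mathcal{A}$ and $\lambda^d(A\cap T_i)=\lambda^d(B\cap T_i)$ for every $i=1,\dots,n$, then $A=B$. Let $d\ge 3$ and let $E\subset\mathbb{R}^d$ be a bounded Lebesgue measurable set of positive Lebesgue measure. Then a translate of $E$ (that is, an element of the family $\{E+x : x\in\mathbb{R}^d\}$) can be reconstructed using $d$ test sets. Indeed, there are measurable sets $T_1,\dots,T_d\subset\mathbb{R}^d$ such that for all $x,x'\in\mathbb{R}^d$ with $x\ne x'$ we have $\lambda^d((E+x)\cap T_i)\neq\lambda^d((E+x')\cap T_i)$ for some $i\in\{1,\dots,d\}$. -/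

import Mathlib

open MeasureTheory

/-- The translate `E + x` of a set `E ⊆ ℝ^d`. -/
def translateSet {d : ℕ} (E : Set (EuclideanSpace ℝ (Fin d))) (x : EuclideanSpace ℝ (Fin d)) :
    Set (EuclideanSpace ℝ (Fin d)) :=
  (fun y => y + x) '' E

/-- An element of the family `𝒜` of Lebesgue measurable subsets of `ℝ^d` of finite measure can be
reconstructed using `n` test sets. Lebesgue measurability (measurability for the completion of
Lebesgue measure on the Borel sets) is `NullMeasurableSet _ volume`. -/
def CanBeReconstructed {d : ℕ} (𝒜 : Set (Set (EuclideanSpace ℝ (Fin d)))) (n : ℕ) : Prop :=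
  (∀ A ∈ 𝒜, NullMeasurableSet A volume ∧ volume A < ⊤) ∧
  ∃ T : Fin n → Set (EuclideanSpace ℝ (Fin d)),
    (∀ i, NullMeasurableSet (T i) volume) ∧
    ∀ A ∈ 𝒜, ∀ B ∈ 𝒜, (∀ i, volume (A ∩ T i) = volume (B ∩ T i)) → A = B

/-! Project Lebesgue measure on `E` to the line by `y ↦ ⟪y, θ⟫`, obtaining a compactly supported
measure `μ`. By Plancherel the characteristic function of `volume.restrict E` is square integrable
on `ℝ^d`. Integration along rays produces a weight `r ^ (d - 1)`, which dominates `r ^ 2` for `r >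
1` because `d ≥ 3`. Hence for almost every `θ` in a shell the function `τ * charFun μ τ` is in `L²`
(`ae_lintegral_ray_lt_top`, `memLp_two_mul_charFun_of_ray`), so `μ` has a distributional derivative
`g` in `L²`. It has compact support, hence lies in `L¹` (`exists_integrable_weak_deriv`).

For such a `μ` a single set `S ⊆ ℝ` recovers the translation parameter. Testing translates of `μ`
against the increasing function `h = 1/2 + arctan / π` gives a strictly increasing quantity. A set
`S` with local density `h`, mixed at a scale that gets finer towards infinity, reproduces this up to
an error whose rate of change in `t` is controlled by `g` and kept below half the rate for `h`
(`exists_strictMono_translate`).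

The preimage of `S` under the projection is a test set in `ℝ^d` that determines `⟪x, θ⟫`. Since
almost every direction works, `d` spanning ones can be chosen, and they determine `x`. -/

open scoped FourierTransform SchwartzMap RealInnerProductSpace ContDiff

/-! ### Plancherel for the indicator of a set of finite measure -/

section Fourier

variable {V : Type*} [NormedAddCommGroup V] [InnerProductSpace ℝ V] [FiniteDimensional ℝ V]
  [MeasurableSpace V] [BorelSpace V]

theorem integral_schwartz_smul_fourier_Lp (ψ : 𝓢(V, ℂ)) (F : Lp (α := V) ℂ 2) :
    ∫ x, ψ x • (𝓕 F : Lp (α := V) ℂ 2) x = ∫ x, (𝓕 ψ) x • F x := by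
  have h := congrArg (fun T => T ψ) (Lp.fourier_toTemperedDistribution_eq F)
  simpa [TemperedDistribution.fourier_apply, Lp.toTemperedDistribution_apply] using h.symm

/-- On `L¹ ∩ L²` the `L²` Fourier transform is given by the Fourier integral. -/
theorem fourier_toLp_ae_eq {f : V → ℂ} (h1 : Integrable f) (h2 : MemLp f 2) :
    ((𝓕 (h2.toLp f) : Lp (α := V) ℂ 2) : V → ℂ) =ᵐ[volume] 𝓕 f := by
  have hcont : Continuous (𝓕 f) := VectorFourier.fourierIntegral_continuous
    Real.continuous_fourierChar continuous_inner h1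
  refine ae_eq_of_integral_contDiff_smul_eq
    ((Lp.memLp _).locallyIntegrable (by norm_num)) hcont.locallyIntegrable ?_
  intro g hg hgc
  have hg₁ : HasCompactSupport (Complex.ofRealCLM ∘ g) := hgc.comp_left rfl
  have hg₂ : ContDiff ℝ ∞ (Complex.ofRealCLM ∘ g) := by fun_prop
  set ψ : 𝓢(V, ℂ) := hg₁.toSchwartzMap hg₂ with hψ
  have e1 := integral_schwartz_smul_fourier_Lp ψ (h2.toLp f)
  have e2 : ∫ x, (𝓕 ψ) x • (h2.toLp f) x = ∫ x, (𝓕 ψ) x • f x := by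
    refine integral_congr_ae ?_
    filter_upwards [h2.coeFn_toLp] with x hx
    rw [hx]
  have e3 : ∫ x, (𝓕 ψ) x • f x = ∫ x, ψ x • (𝓕 f) x := by
    rw [SchwartzMap.fourier_coe]
    have := VectorFourier.integral_fourierIntegral_smul_eq_flip (L := innerₗ V) (f := ψ) (g := f)
      (μ := volume) (ν := volume) Real.continuous_fourierChar continuous_inner ψ.integrable h1
    simpa using! this
  simpa [hψ] using e1.trans (e2.trans e3)

/-- Only the normalisation differs: `charFun` uses `exp (i⟪x, ξ⟫)` and `𝓕` uses `exp (-2πi⟪x, ξ⟫)`.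
-/
theorem charFun_restrict_eq_fourier {E : Set V} (hE : NullMeasurableSet E) (ξ : V) :
    charFun (volume.restrict E) ξ
      = 𝓕 (E.indicator (fun _ => (1 : ℂ))) (-(2 * Real.pi)⁻¹ • ξ) := by
  rw [charFun_eq_fourierIntegral']
  simp only [VectorFourier.fourierIntegral, Real.fourier_eq]
  rw [← integral_indicator₀ hE]
  congr 1
  ext v
  by_cases hv : v ∈ E <;> simp [hv]

/-- The indicator of `E` is in `L¹ ∩ L²`, so its Fourier integral represents its `L²` transform;
rescaling the variable preserves `L²`. -/
theorem lintegral_charFun_restrict_sq_lt_top {E : Set V} (hE : NullMeasurableSet E)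
    (hfin : volume E ≠ ⊤) :
    ∫⁻ ξ, ‖charFun (volume.restrict E) ξ‖ₑ ^ 2 < ⊤ := by
  have mp (p : ENNReal) : MemLp (E.indicator (fun _ => (1 : ℂ))) p volume :=
    (memLp_indicator_const p (measurableSet_toMeasurable volume E) (1 : ℂ)
      (Or.inr (by rwa [measure_toMeasurable]))).ae_eq
      (indicator_ae_eq_of_ae_eq_set hE.toMeasurable_ae_eq)
  have key : MemLp (𝓕 (E.indicator (fun _ => (1 : ℂ)))) 2 volume :=
    (Lp.memLp _).ae_eq (fourier_toLp_ae_eq (memLp_one_iff_integrable.1 (mp 1)) (mp 2))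
  have k2 : MemLp (charFun (volume.restrict E)) 2 volume := by
    have : charFun (volume.restrict E)
        = fun ξ => 𝓕 (E.indicator (fun _ => (1 : ℂ))) (-(2 * Real.pi)⁻¹ • ξ) :=
      funext (charFun_restrict_eq_fourier hE)
    rw [this]
    have hne : (-(2 * Real.pi)⁻¹ : ℝ) ≠ 0 := by
      simp [Real.pi_ne_zero]
    refine MemLp.comp_of_map (f := fun ξ : V => -(2 * Real.pi)⁻¹ • ξ) ?_ (by fun_prop)
    rw [Measure.map_addHaar_smul _ hne]
    exact key.smul_measure ENNReal.ofReal_ne_top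
  have := (lintegral_rpow_enorm_lt_top_of_eLpNorm_lt_top (p := 2) (by norm_num) (by norm_num)
    k2.eLpNorm_lt_top)
  simpa using this

end Fourier

/-! ### Measures on the line with an integrable distributional derivative -/

section WeakDerivative

theorem integrable_of_memLp_two_of_ae_eq_zero {F : ℝ → ℂ} (hF : MemLp F 2) {R : ℝ}
    (h0 : ∀ᵐ y, y ∉ Set.Icc (-R) R → F y = 0) : Integrable F := by
  have h : IntegrableOn F (Set.Icc (-R) R) :=
    (hF.restrict _).integrable (by norm_num)
  refine ((integrable_indicator_iff measurableSet_Icc).2 h).congr ?_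
  filter_upwards [h0] with y hy
  by_cases hy' : y ∈ Set.Icc (-R) R
  · simp [hy']
  · simp [hy', hy hy']

theorem schwartz_deriv_fourier (ψ : 𝓢(ℝ, ℂ)) :
    Integrable (fun x : ℝ => (2 * Real.pi * Complex.I * x) * ψ x) ∧
    ∀ y, deriv (𝓕 (ψ : ℝ → ℂ)) y
      = - 𝓕 (fun x : ℝ => (2 * Real.pi * Complex.I * x) * ψ x) y := by
  have hi : Integrable (fun x : ℝ => x • ψ x) := by
    refine (ψ.integrable_pow_mul volume 1).mono
      ((continuous_id.smul ψ.continuous).aestronglyMeasurable) (.of_forall fun x => ?_)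
    simp
  refine ⟨?_, fun y => ?_⟩
  · refine (hi.const_mul (2 * Real.pi * Complex.I)).congr (.of_forall fun x => ?_)
    simp only [Complex.real_smul]; ring
  · rw [Real.deriv_fourier ψ.integrable hi, Real.fourier_eq, Real.fourier_eq, ← integral_neg]
    congr 1
    ext x
    rw [← smul_neg]
    congr 1
    simp only [smul_eq_mul]; ring

/-- The transform prescribed for `F` is that of the derivative of `μ`. Writing `Φ = 𝓕 ψ` moves the
transform onto `F`; the factor `2πiξ` is absorbed into `ψ`, where it becomes `-Φ'` after
transforming back. -/
theorem integral_deriv_schwartz_eq {μ : Measure ℝ} [IsFiniteMeasure μ] (F : Lp (α := ℝ) ℂ 2 volume)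
    (hF : (𝓕 F : Lp (α := ℝ) ℂ 2 volume) =ᵐ[volume]
      fun ξ => (2 * Real.pi * Complex.I * ξ) * charFun μ (-(2 * Real.pi) * ξ))
    (Φ : 𝓢(ℝ, ℂ)) : ∫ x, Φ x • F x = - ∫ y, deriv Φ y ∂μ := by
  set ψ : 𝓢(ℝ, ℂ) := 𝓕⁻ Φ with hψ
  have hΦ : 𝓕 ψ = Φ := FourierTransform.fourier_fourierInv_eq Φ
  obtain ⟨hi, hd⟩ := schwartz_deriv_fourier ψ
  have e1 := integral_schwartz_smul_fourier_Lp ψ F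
  rw [hΦ] at e1
  rw [← e1]
  have e0 : (𝓕 (ψ : ℝ → ℂ)) = Φ := by rw [← SchwartzMap.fourier_coe, hΦ]
  rw [e0] at hd
  have e2 : ∫ x, ψ x • (𝓕 F : Lp (α := ℝ) ℂ 2 volume) x
      = ∫ x : ℝ, VectorFourier.fourierIntegral Real.fourierChar μ (innerₗ ℝ) (1 : ℝ → ℂ) x •
        ((2 * Real.pi * Complex.I * x) * ψ x) := by
    refine integral_congr_ae ?_
    filter_upwards [hF] with x hx
    rw [hx, charFun_eq_fourierIntegral']
    have : -(2 * Real.pi)⁻¹ • (-(2 * Real.pi) * x) = x := by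
      have := Real.pi_ne_zero
      simp only [smul_eq_mul]; field_simp
    rw [this]
    simp only [smul_eq_mul]; ring
  rw [e2, VectorFourier.integral_fourierIntegral_smul_eq_flip Real.continuous_fourierChar
    continuous_inner (f := 1) (integrable_const (1 : ℂ)) hi, ← integral_neg]
  congr 1
  ext y
  rw [hd, neg_neg]
  simp only [Pi.one_apply, one_smul]
  simp [VectorFourier.fourierIntegral, Real.fourier_eq, mul_comm]

/-- A compactly supported finite measure `μ` on the line with `τ ↦ τ * charFun μ τ` in `L²` has a
compactly supported integrable derivative. -/
theorem exists_integrable_weak_deriv {μ : Measure ℝ} [IsFiniteMeasure μ] {R : ℝ}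
    (hR : μ (Set.Icc (-R) R)ᶜ = 0) (h2 : MemLp (fun τ : ℝ => (τ : ℂ) * charFun μ τ) 2) :
    ∃ g : ℝ → ℝ, Integrable g ∧ (∀ y, y ∉ Set.Icc (-R) R → g y = 0) ∧
      ∀ τ : ℝ, ∫ y : ℝ, Complex.exp (τ * y * Complex.I) * g y
        = -(Complex.I * τ * charFun μ τ) := by
  have hG : MemLp (fun ξ : ℝ => (2 * Real.pi * Complex.I * ξ) * charFun μ (-(2 * Real.pi) * ξ))
      2 volume := by
    have hne : (-(2 * Real.pi) : ℝ) ≠ 0 := by simp [Real.pi_ne_zero]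
    have : MemLp (fun ξ : ℝ => ((-(2 * Real.pi) • ξ : ℝ) : ℂ) * charFun μ (-(2 * Real.pi) • ξ))
        2 volume := by
      refine MemLp.comp_of_map (f := fun ξ : ℝ => -(2 * Real.pi) • ξ)
        (g := fun τ : ℝ => (τ : ℂ) * charFun μ τ) ?_ (by fun_prop)
      rw [Measure.map_addHaar_smul _ hne]
      exact h2.smul_measure ENNReal.ofReal_ne_top
    refine (this.const_mul (-Complex.I)).ae_eq (.of_forall fun ξ => ?_)
    simp only [smul_eq_mul]
    push_cast
    ring
  set F : Lp (α := ℝ) ℂ 2 volume := 𝓕⁻ (hG.toLp _ : Lp (α := ℝ) ℂ 2 volume)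
  have hF : (𝓕 F : Lp (α := ℝ) ℂ 2 volume) =ᵐ[volume]
      fun ξ => (2 * Real.pi * Complex.I * ξ) * charFun μ (-(2 * Real.pi) * ξ) := by
    have : 𝓕 F = (hG.toLp _ : Lp (α := ℝ) ℂ 2 volume) := FourierTransform.fourier_fourierInv_eq _
    rw [this]
    exact hG.coeFn_toLp
  have hloc : LocallyIntegrable F volume := (Lp.memLp F).locallyIntegrable (by norm_num)
  -- A test function supported off `[-R, R]` has derivative zero `μ`-almost everywhere, so its
  -- pairing with `F` vanishes.
  have hsupp : ∀ᵐ y, y ∈ (Set.Icc (-R) R)ᶜ → F y = 0 := by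
    refine isClosed_Icc.isOpen_compl.ae_eq_zero_of_integral_contDiff_smul_eq_zero
      (hloc.locallyIntegrableOn _) ?_
    intro g hg hgc hgs
    have hg₁ : HasCompactSupport (Complex.ofRealCLM ∘ g) := hgc.comp_left rfl
    have hg₂ : ContDiff ℝ ∞ (Complex.ofRealCLM ∘ g) := by fun_prop
    have e := integral_deriv_schwartz_eq F hF (hg₁.toSchwartzMap hg₂)
    have e0 : ∫ y, deriv (hg₁.toSchwartzMap hg₂) y ∂μ = 0 := by
      refine integral_eq_zero_of_ae ?_
      have : ∀ᵐ y ∂μ, y ∈ Set.Icc (-R) R := by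
        rw [ae_iff]; exact hR
      filter_upwards [this] with y hy
      by_contra hne
      have h1 : y ∈ tsupport (Complex.ofRealCLM ∘ g) := by
        apply support_deriv_subset
        exact hne
      exact hgs (closure_mono (Function.support_comp_subset (by simp) g) h1) hy
    rw [e0] at e
    simpa using e
  have hint : Integrable F volume :=
    integrable_of_memLp_two_of_ae_eq_zero (Lp.memLp F) hsupp
  have hFT : 𝓕 (F : ℝ → ℂ)
      = fun ξ => (2 * Real.pi * Complex.I * ξ) * charFun μ (-(2 * Real.pi) * ξ) := by
    have hc1 : Continuous (𝓕 (F : ℝ → ℂ)) := VectorFourier.fourierIntegral_continuous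
      Real.continuous_fourierChar continuous_inner hint
    have hc2 : Continuous (charFun μ) := by
      have := VectorFourier.fourierIntegral_continuous (μ := μ) (L := innerₗ ℝ)
        (f := (1 : ℝ → ℂ)) Real.continuous_fourierChar continuous_inner (integrable_const (1 : ℂ))
      rw [funext (charFun_eq_fourierIntegral' (μ := μ))]
      exact this.comp (by fun_prop)
    refine (Continuous.ae_eq_iff_eq volume hc1 (by fun_prop)).1 ?_
    have := fourier_toLp_ae_eq hint (Lp.memLp F)
    rw [Lp.toLp_coeFn] at this
    exact this.symm.trans hF
  have hexp : ∀ τ : ℝ, ∫ y : ℝ, Complex.exp (τ * y * Complex.I) * F y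
      = -(Complex.I * τ * charFun μ τ) := by
    intro τ
    have h := congrFun hFT (-(2 * Real.pi)⁻¹ * τ)
    have hpi := Real.pi_ne_zero
    have hpi' : (Real.pi : ℂ) ≠ 0 := by exact_mod_cast hpi
    have e1 : -(2 * Real.pi) * (-(2 * Real.pi)⁻¹ * τ) = τ := by field_simp
    rw [e1, Real.fourier_real_eq_integral_exp_smul] at h
    have e2 : (2 * Real.pi * Complex.I * ((-(2 * Real.pi)⁻¹ * τ : ℝ) : ℂ)) * charFun μ τ
        = -(Complex.I * τ * charFun μ τ) := by
      push_cast; field_simp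
    rw [← e2, ← h]
    congr 1
    ext y
    rw [smul_eq_mul]
    congr 2
    push_cast
    field_simp
  -- Since `μ` is real, `charFun μ (-τ)` is the conjugate of `charFun μ τ`; thus `conj F` has the
  -- same transform as `F`, and so has the real part of `F`.
  have hexp' : ∀ τ : ℝ, ∫ y : ℝ, Complex.exp (τ * y * Complex.I) * (starRingEnd ℂ) (F y)
      = -(Complex.I * τ * charFun μ τ) := by
    intro τ
    have h := congrArg (starRingEnd ℂ) (hexp (-τ))
    rw [← integral_conj, charFun_neg] at h
    simpa [← Complex.exp_conj] using h
  have hgi : Integrable (fun y => (F y).re) volume := hint.re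
  refine ⟨(Set.Icc (-R) R).indicator fun y => (F y).re, hgi.indicator measurableSet_Icc,
    fun y hy => by simp [hy], fun τ => ?_⟩
  have hbd : ∀ G : ℝ → ℂ, Integrable G →
      Integrable (fun y : ℝ => Complex.exp (τ * y * Complex.I) * G y) := by
    intro G hG'
    refine hG'.bdd_mul (c := 1) (by fun_prop) (.of_forall fun y => ?_)
    rw [← Complex.ofReal_mul, Complex.norm_exp_ofReal_mul_I]
  have e3 : ∫ y : ℝ, Complex.exp (τ * y * Complex.I) *
        (((Set.Icc (-R) R).indicator (fun y => (F y).re) y : ℝ) : ℂ)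
      = ∫ y : ℝ, (2⁻¹ : ℂ) * (Complex.exp (τ * y * Complex.I) * F y
        + Complex.exp (τ * y * Complex.I) * (starRingEnd ℂ) (F y)) := by
    refine integral_congr_ae ?_
    filter_upwards [hsupp] with y hy
    rw [← mul_add, Complex.add_conj]
    by_cases hy' : y ∈ Set.Icc (-R) R
    · simp [hy']; ring
    · simp [hy', hy hy']
  have hconj : Integrable (fun y => (starRingEnd ℂ) (F y)) volume :=
    (LinearIsometryEquiv.integrable_comp_iff Complex.conjLIE).2 hint
  rw [e3, integral_const_mul, integral_add (hbd _ hint) (hbd _ hconj), hexp, hexp']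
  ring

end WeakDerivative

/-! ### Translates of a measure in terms of its derivative -/

section TranslationFormula

theorem isFiniteMeasure_withDensity_ofReal_real {g : ℝ → ℝ} (hg : Integrable g) :
    IsFiniteMeasure (volume.withDensity fun y => ENNReal.ofReal (g y)) :=
  isFiniteMeasure_withDensity_ofReal hg.2

theorem integral_withDensity_pos_sub_neg {G : Type*} [NormedAddCommGroup G] [NormedSpace ℝ G]
    {g : ℝ → ℝ} (hg : Integrable g) {f : ℝ → G} (hf : StronglyMeasurable f) {C : ℝ}
    (hC : ∀ y, ‖f y‖ ≤ C) :
    (∫ y, f y ∂volume.withDensity fun y => ENNReal.ofReal (g y))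
      - (∫ y, f y ∂volume.withDensity fun y => ENNReal.ofReal (-g y)) = ∫ y, g y • f y := by
  have key (k : ℝ → ℝ) (hk : Integrable k) :
      Integrable (fun y => max (k y) 0 • f y) ∧
      ∫ y, f y ∂(volume.withDensity fun y => ENNReal.ofReal (k y))
        = ∫ y, max (k y) 0 • f y := by
    refine ⟨hk.pos_part.smul_bdd C hf.aestronglyMeasurable (.of_forall hC), ?_⟩
    rw [integral_withDensity_eq_integral_toReal_smul₀ hk.aemeasurable.ennreal_ofReal
      (.of_forall fun _ => ENNReal.ofReal_lt_top)]
    simp [ENNReal.toReal_ofReal']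
  rw [(key g hg).2, (key (fun y => -g y) hg.neg).2, ← integral_sub (key g hg).1 (key (fun y => -g y) hg.neg).1]
  congr 1
  ext y
  rw [← sub_smul]
  congr 1
  simp

theorem charFun_restrict_Ioc {s s' : ℝ} (hs : s ≤ s') (τ : ℝ) :
    Complex.I * τ * charFun (volume.restrict (Set.Ioc s s')) τ
      = Complex.exp (τ * s' * Complex.I) - Complex.exp (τ * s * Complex.I) := by
  rw [charFun_apply_real, ← intervalIntegral.integral_of_le hs]
  rcases eq_or_ne τ 0 with rfl | hτ
  · simp
  · have h := integral_exp_mul_complex (a := s) (b := s') (c := Complex.I * τ)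
      (by simp [hτ])
    have e : (fun x : ℝ => Complex.exp (τ * x * Complex.I))
        = fun x : ℝ => Complex.exp (Complex.I * τ * x) := by
      ext x; congr 1; ring
    rw [e, h, mul_div_cancel₀ _ (by simp [hτ])]
    congr 2 <;> ring

/-- This is `δ_{s'} ∗ μ - δ_s ∗ μ = -(1_{(s, s']} ∗ g)`, with `g` split into positive and negative
parts and rearranged so that both sides are finite positive measures, which characteristic functions
separate. -/
theorem dirac_conv_add_eq {μ : Measure ℝ} [IsFiniteMeasure μ] {g : ℝ → ℝ} (hg : Integrable g)
    (hFT : ∀ τ : ℝ, ∫ y : ℝ, Complex.exp (τ * y * Complex.I) * g y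
      = -(Complex.I * τ * charFun μ τ)) {s s' : ℝ} (hs : s ≤ s') :
    (Measure.dirac s' ∗ μ) + (volume.restrict (Set.Ioc s s') ∗
        volume.withDensity fun y => ENNReal.ofReal (g y))
      = (Measure.dirac s ∗ μ) + (volume.restrict (Set.Ioc s s') ∗
        volume.withDensity fun y => ENNReal.ofReal (-g y)) := by
  have := isFiniteMeasure_withDensity_ofReal_real hg
  have := isFiniteMeasure_withDensity_ofReal_real (g := fun y => -g y) hg.neg
  refine Measure.ext_of_charFun (funext fun τ => ?_)
  have hadd (m n : Measure ℝ) [IsFiniteMeasure m] [IsFiniteMeasure n] :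
      charFun (m + n) τ = charFun m τ + charFun n τ := by
    rw [charFun_apply, charFun_apply, charFun_apply, integral_add_measure] <;>
    · refine (integrable_const (1 : ℝ)).mono' (by fun_prop) (.of_forall fun y => ?_)
      rw [Complex.norm_exp_ofReal_mul_I]
  rw [hadd, hadd, charFun_conv, charFun_conv, charFun_conv, charFun_conv, charFun_dirac,
    charFun_dirac]
  have h1 := integral_withDensity_pos_sub_neg hg
    (f := fun y : ℝ => Complex.exp (τ * y * Complex.I))
    (Continuous.stronglyMeasurable (by fun_prop)) (C := 1)
    (fun y => by rw [← Complex.ofReal_mul, Complex.norm_exp_ofReal_mul_I])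
  have h2 : ∫ y : ℝ, g y • Complex.exp (τ * y * Complex.I)
      = ∫ y : ℝ, Complex.exp (τ * y * Complex.I) * g y := by
    congr 1
    ext y
    rw [Complex.real_smul, mul_comm]
  rw [h2, hFT, ← charFun_apply_real, ← charFun_apply_real] at h1
  have h3 := charFun_restrict_Ioc hs τ
  have e (t : ℝ) : ((inner ℝ t τ : ℝ) : ℂ) = τ * t := by simp
  rw [e, e]
  linear_combination (charFun (volume.restrict (Set.Ioc s s')) τ) * h1 - charFun μ τ * h3

theorem integral_translate_sub {μ : Measure ℝ} [IsFiniteMeasure μ] {g : ℝ → ℝ}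
    (hg : Integrable g)
    (hFT : ∀ τ : ℝ, ∫ y : ℝ, Complex.exp (τ * y * Complex.I) * g y
      = -(Complex.I * τ * charFun μ τ)) {s s' : ℝ} (hs : s ≤ s') {u : ℝ → ℝ}
    (hu : Measurable u) {C : ℝ} (hC : ∀ y, ‖u y‖ ≤ C) :
    ∫ y, u (s' + y) ∂μ - ∫ y, u (s + y) ∂μ = - ∫ t in s..s', ∫ y, g y * u (t + y) := by
  have i1 := isFiniteMeasure_withDensity_ofReal_real hg
  have i2 := isFiniteMeasure_withDensity_ofReal_real (g := fun y => -g y) hg.neg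
  have hb (m : Measure ℝ) [IsFiniteMeasure m] : Integrable u m :=
    (integrable_const C).mono' hu.aestronglyMeasurable (.of_forall hC)
  have h := congrArg (fun m => ∫ y, u y ∂m) (dirac_conv_add_eq hg hFT hs)
  have hj (m : Measure ℝ) [IsFiniteMeasure m] :
      Integrable (fun t => ∫ y, u (t + y) ∂m) (volume.restrict (Set.Ioc s s')) := by
    refine (integrable_const (C * m.real Set.univ)).mono' ?_ (.of_forall fun t => ?_)
    · exact (StronglyMeasurable.integral_prod_right
        (f := fun t y : ℝ => u (t + y))
        (hu.comp (by fun_prop : Measurable fun p : ℝ × ℝ => p.1 + p.2)).stronglyMeasurable).aestronglyMeasurable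
    · exact norm_integral_le_of_norm_le_const (.of_forall fun y => hC _)
  rw [integral_add_measure (hb _) (hb _), integral_add_measure (hb _) (hb _),
    integral_conv (hb _), integral_conv (hb _), integral_conv (hb _), integral_conv (hb _),
    integral_dirac, integral_dirac] at h
  have h2 : ∫ t in s..s', ∫ y, g y * u (t + y)
      = (∫ t in Set.Ioc s s', ∫ y, u (t + y) ∂volume.withDensity fun y => ENNReal.ofReal (g y))
      - ∫ t in Set.Ioc s s', ∫ y, u (t + y) ∂volume.withDensity
          fun y => ENNReal.ofReal (-g y) := by
    rw [intervalIntegral.integral_of_le hs, ← integral_sub (hj _) (hj _)]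
    congr 1
    ext t
    exact (integral_withDensity_pos_sub_neg hg (f := fun y => u (t + y))
      (hu.comp (by fun_prop)).stronglyMeasurable (fun y => hC (t + y))).symm
  rw [h2]
  linarith

end TranslationFormula

/-! ### A set on the line with prescribed local density -/

section TestSetOnLine

/-- The set that in each cell `[m / N, (m + 1) / N)` is an initial segment of length equal to the
integral of `h` over the cell. -/
def cellSet (h : ℝ → ℝ) (N : ℕ) : Set ℝ :=
  {y | Int.fract (N * y) < N * ∫ z in ((⌊N * y⌋ : ℤ) / N : ℝ)..(((⌊N * y⌋ : ℤ) + 1) / N : ℝ), h z}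

theorem measurableSet_cellSet (h : ℝ → ℝ) (N : ℕ) : MeasurableSet (cellSet h N) := by
  refine measurableSet_lt (by fun_prop) ?_
  have h1 : Measurable fun m : ℤ => (N : ℝ) * ∫ z in ((m : ℤ) / N : ℝ)..(((m : ℤ) + 1) / N : ℝ), h z :=
    measurable_from_top
  exact h1.comp (Int.measurable_floor.comp (by fun_prop))

theorem intervalIntegrable_of_bounded {u : ℝ → ℝ} (hu : Measurable u) {C : ℝ}
    (hC : ∀ y, ‖u y‖ ≤ C) (a b : ℝ) : IntervalIntegrable u volume a b :=
  IntervalIntegrable.mono_fun' (g := fun _ => C) (by simp) hu.aestronglyMeasurable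
    (.of_forall hC)

theorem integral_cellSet_sub {h : ℝ → ℝ} (hm : Measurable h) (h0 : ∀ y, 0 ≤ h y)
    (h1 : ∀ y, h y ≤ 1) {N : ℕ} (hN : 0 < N) (m : ℤ) :
    ∫ y in (m / N : ℝ)..((m + 1) / N : ℝ), ((cellSet h N).indicator 1 y - h y) = 0 := by
  have hN' : (0 : ℝ) < N := by exact_mod_cast hN
  set a : ℝ := m / N with ha
  set b : ℝ := (m + 1) / N with hb
  set c : ℝ := ∫ y in a..b, h y with hc
  have hab : a ≤ b := by rw [ha, hb]; gcongr; linarith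
  have hba : b - a = 1 / N := by rw [ha, hb]; ring
  have hbd : ∀ y, ‖h y‖ ≤ 1 := fun y => by rw [Real.norm_of_nonneg (h0 y)]; exact h1 y
  have hI := intervalIntegrable_of_bounded hm hbd a b
  have c0 : 0 ≤ c := intervalIntegral.integral_nonneg hab fun y _ => h0 y
  have c1 : c ≤ b - a := by
    calc c ≤ ∫ _ in a..b, (1 : ℝ) :=
          intervalIntegral.integral_mono_on hab hI (by simp) fun y _ => h1 y
      _ = b - a := by simp
  have hset : cellSet h N ∩ Set.Ico a b = Set.Ico a (a + c) := by
    ext y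
    have hfl : y ∈ Set.Ico a b → ⌊N * y⌋ = m := by
      rintro ⟨hy1, hy2⟩
      rw [Int.floor_eq_iff]
      rw [ha, div_le_iff₀ hN'] at hy1
      rw [hb, lt_div_iff₀ hN'] at hy2
      constructor <;> linarith
    have key : y ∈ Set.Ico a b → (y ∈ cellSet h N ↔ y < a + c) := by
      intro hy
      have e : Int.fract (N * y) = N * (y - a) := by
        rw [Int.fract, hfl hy, ha]; field_simp
      change Int.fract (N * y) < N * _ ↔ _
      rw [e, hfl hy, mul_lt_mul_iff_right₀ hN', sub_lt_iff_lt_add']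
    constructor
    · rintro ⟨hy1, hy2⟩
      exact ⟨hy2.1, (key hy2).1 hy1⟩
    · rintro ⟨hy1, hy2⟩
      have hy : y ∈ Set.Ico a b := ⟨hy1, by linarith⟩
      exact ⟨(key hy).2 hy2, hy⟩
  have hS : ∫ y in a..b, (cellSet h N).indicator (1 : ℝ → ℝ) y = c := by
    rw [intervalIntegral.integral_of_le hab, ← integral_Ico_eq_integral_Ioc,
      integral_indicator_one (measurableSet_cellSet h N), measureReal_restrict_apply
      (measurableSet_cellSet h N), hset]
    simp [c0]
  have hind : ∀ y, ‖(cellSet h N).indicator (1 : ℝ → ℝ) y‖ ≤ 1 := fun y => by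
    by_cases hy : y ∈ cellSet h N <;> simp [hy]
  rw [intervalIntegral.integral_sub (intervalIntegrable_of_bounded
    (measurable_one.indicator (measurableSet_cellSet h N)) hind a b) hI, hS, hc, sub_self]

/-- As `u` has mean zero on each cell, a constant may be subtracted from `g` there, leaving only the
oscillation of `g` over a length `1 / N`. -/
theorem abs_integral_mul_translate_le_of_cell {u g : ℝ → ℝ} (hu : Measurable u)
    (hu1 : ∀ y, ‖u y‖ ≤ 1) {N : ℕ} (hN : 0 < N)
    (hcell : ∀ m : ℤ, ∫ y in (m / N : ℝ)..((m + 1) / N : ℝ), u y = 0)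
    (hg : Continuous g) {η : ℝ} (hη : ∀ x y : ℝ, |x - y| ≤ 1 / N → |g x - g y| ≤ η) (k : ℤ) (x : ℝ) :
    |∫ y in (k : ℝ)..(k + 1), u y * g (y - x)| ≤ η := by
  have hN' : (0 : ℝ) < N := by exact_mod_cast hN
  have hui := intervalIntegrable_of_bounded hu hu1
  set a : ℕ → ℝ := fun j => k + j / N with ha
  have hint (a b : ℝ) : IntervalIntegrable (fun y => u y * g (y - x)) volume a b :=
    (hui a b).mul_continuousOn (by fun_prop)
  have hsum := intervalIntegral.sum_integral_adjacent_intervals (n := N) (a := a)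
    (fun j _ => hint (a j) (a (j + 1)))
  have e0 : a 0 = k := by simp [ha]
  have eN : a N = k + 1 := by simp [ha, hN'.ne']
  rw [e0, eN] at hsum
  rw [← hsum]
  refine (Finset.abs_sum_le_sum_abs _ _).trans ?_
  have hle : ∀ j ∈ Finset.range N, |∫ y in a j..a (j + 1), u y * g (y - x)| ≤ η / N := by
    intro j _
    have hd : a (j + 1) - a j = 1 / N := by simp [ha]; ring
    have hzero : ∫ y in a j..a (j + 1), u y = 0 := by
      have := hcell (k * N + j)
      have q1 : (((k * N + j : ℤ) : ℝ) / N) = a j := by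
        simp only [ha]; push_cast; field_simp
      have q2 : ((((k * N + j : ℤ) : ℝ) + 1) / N) = a (j + 1) := by
        simp only [ha]; push_cast; field_simp; ring
      rwa [q1, q2] at this
    have e : ∫ y in a j..a (j + 1), u y * g (y - x)
        = ∫ y in a j..a (j + 1), u y * (g (y - x) - g (a j - x)) := by
      have : (fun y => u y * (g (y - x) - g (a j - x)))
          = fun y => u y * g (y - x) - u y * g (a j - x) := by
        ext y; ring
      rw [this, intervalIntegral.integral_sub (hint _ _) ((hui _ _).mul_const _),
        intervalIntegral.integral_mul_const, hzero]
      simp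
    rw [e, ← Real.norm_eq_abs]
    have hpos : 0 < a (j + 1) - a j := by rw [hd]; positivity
    refine (intervalIntegral.norm_integral_le_of_norm_le_const (C := η) ?_).trans ?_
    · intro y hy
      rw [Set.uIoc_of_le (by linarith)] at hy
      rw [norm_mul]
      have h1 : ‖g (y - x) - g (a j - x)‖ ≤ η := by
        refine hη _ _ ?_
        rw [← hd, abs_le]
        constructor <;> linarith [hy.1, hy.2]
      calc ‖u y‖ * ‖g (y - x) - g (a j - x)‖ ≤ 1 * η := by
            gcongr
            exact hu1 y
        _ = η := one_mul η
    · rw [hd, abs_of_pos (by positivity)]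
      exact le_of_eq (by ring)
  refine (Finset.sum_le_sum hle).trans ?_
  rw [Finset.sum_const, Finset.card_range, nsmul_eq_mul]
  exact le_of_eq (by field_simp)

/-- Approximating `g` in `L¹` by a continuous compactly supported, hence uniformly continuous,
function gives an `N` that serves all `u`, all translates and all unit intervals at once. -/
theorem exists_cell_size {g : ℝ → ℝ} (hg : Integrable g) {ε : ℝ} (hε : 0 < ε) :
    ∃ N : ℕ, 0 < N ∧ ∀ u : ℝ → ℝ, Measurable u → (∀ y, ‖u y‖ ≤ 1) →
      (∀ m : ℤ, ∫ y in (m / N : ℝ)..((m + 1) / N : ℝ), u y = 0) →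
      ∀ (k : ℤ) (x : ℝ), |∫ y in (k : ℝ)..(k + 1), u y * g (y - x)| ≤ ε := by
  obtain ⟨g₀, hc, hd, hcont, hi⟩ := hg.exists_hasCompactSupport_integral_sub_le (half_pos hε)
  have huc : UniformContinuous g₀ := hcont.uniformContinuous_of_tendsto_cocompact
    hc.is_zero_at_infty
  obtain ⟨δ, hδ, hδ'⟩ := Metric.uniformContinuous_iff.1 huc (ε / 2) (half_pos hε)
  obtain ⟨n, hn⟩ := exists_nat_one_div_lt hδ
  refine ⟨n + 1, n.succ_pos, fun u hu hu1 hcell k x => ?_⟩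
  have h1 := abs_integral_mul_translate_le_of_cell hu hu1 n.succ_pos hcell hcont (η := ε / 2)
    (fun p q hpq => (hδ' (lt_of_le_of_lt hpq (by exact_mod_cast hn))).le) k x
  have hb {f : ℝ → ℝ} (hf : Integrable f) : Integrable (fun y => u y * f (y - x)) :=
    (hf.comp_sub_right x).bdd_mul hu.aestronglyMeasurable (.of_forall hu1)
  have h2 : |∫ y in (k : ℝ)..(k + 1), u y * (g (y - x) - g₀ (y - x))| ≤ ε / 2 := by
    refine (intervalIntegral.abs_integral_le_integral_abs (by linarith)).trans ?_
    rw [intervalIntegral.integral_of_le (by linarith)]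
    have hgi : Integrable fun y => |g (y - x) - g₀ (y - x)| :=
      ((hg.sub hi).comp_sub_right x).abs
    calc ∫ y in Set.Ioc (k : ℝ) (k + 1), |u y * (g (y - x) - g₀ (y - x))|
        ≤ ∫ y in Set.Ioc (k : ℝ) (k + 1), |g (y - x) - g₀ (y - x)| := by
          refine integral_mono_of_nonneg (.of_forall fun y => abs_nonneg _) hgi.integrableOn
            (.of_forall fun y => ?_)
          change |u y * _| ≤ _
          rw [abs_mul]
          exact mul_le_of_le_one_left (abs_nonneg _) (hu1 y)
      _ ≤ ∫ y, |g (y - x) - g₀ (y - x)| :=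
          setIntegral_le_integral hgi (.of_forall fun y => abs_nonneg _)
      _ = ∫ y, |g y - g₀ y| := integral_sub_right_eq_self (fun y => |g y - g₀ y|) x
      _ ≤ ε / 2 := hd
  have e : ∫ y in (k : ℝ)..(k + 1), u y * g (y - x)
      = (∫ y in (k : ℝ)..(k + 1), u y * g₀ (y - x))
        + ∫ y in (k : ℝ)..(k + 1), u y * (g (y - x) - g₀ (y - x)) := by
    rw [← intervalIntegral.integral_add (hb hi).intervalIntegrable
      (hb (f := fun y => g y - g₀ y) (hg.sub hi)).intervalIntegrable]
    congr 1
    ext y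
    ring
  rw [e]
  exact (abs_add_le _ _).trans (by linarith)

theorem exists_testSet_density {g h : ℝ → ℝ} (hg : Integrable g) (hm : Measurable h)
    (h0 : ∀ y, 0 ≤ h y) (h1 : ∀ y, h y ≤ 1) {ε : ℤ → ℝ} (hε : ∀ k, 0 < ε k) :
    ∃ S : Set ℝ, MeasurableSet S ∧ ∀ (k : ℤ) (x : ℝ),
      |∫ y in (k : ℝ)..(k + 1), (S.indicator 1 y - h y) * g (y - x)| ≤ ε k := by
  choose N hN hN' using fun k => exists_cell_size hg (hε k)
  refine ⟨⋃ k : ℤ, cellSet h (N k) ∩ Set.Ico (k : ℝ) (k + 1),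
    .iUnion fun k => (measurableSet_cellSet h _).inter measurableSet_Ico, fun k x => ?_⟩
  have hk := hN' k (fun y => (cellSet h (N k)).indicator 1 y - h y)
    ((measurable_one.indicator (measurableSet_cellSet h _)).sub hm) (fun y => ?_)
    (fun m => integral_cellSet_sub hm h0 h1 (hN k) m) k x
  · convert hk using 2
    rw [intervalIntegral.integral_of_le (by linarith),
      intervalIntegral.integral_of_le (by linarith), ← integral_Ico_eq_integral_Ioc,
      ← integral_Ico_eq_integral_Ioc]
    refine setIntegral_congr_fun measurableSet_Ico fun y hy => ?_
    have : y ∈ (⋃ k : ℤ, cellSet h (N k) ∩ Set.Ico (k : ℝ) (k + 1)) ↔ y ∈ cellSet h (N k) := by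
      rw [Set.mem_iUnion]
      refine ⟨?_, fun hy' => ⟨k, hy', hy⟩⟩
      rintro ⟨j, hj, hj'⟩
      have e : j = k := by
        rw [← Int.floor_eq_iff.2 hj', Int.floor_eq_iff.2 hy]
      rwa [← e]
    by_cases hyc : y ∈ cellSet h (N k)
    · simp only [Set.indicator_of_mem hyc, Set.indicator_of_mem (this.2 hyc)]
    · simp only [Set.indicator_of_notMem hyc, Set.indicator_of_notMem (mt this.1 hyc)]
  · have a0 := h0 y
    have a1 := h1 y
    rw [Real.norm_eq_abs, abs_le]
    by_cases hy : y ∈ cellSet h (N k) <;> simp [hy] <;> constructor <;> linarith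

end TestSetOnLine

/-! ### Recovering a translate on the line from one test set -/

section TranslateMeasureOnLine

theorem abs_integral_mul_translate_le_sum {g u : ℝ → ℝ} (hg : Integrable g) {n : ℕ}
    (hg0 : ∀ y, y ∉ Set.Icc (-n : ℝ) n → g y = 0) (hu : Measurable u) (hu1 : ∀ y, ‖u y‖ ≤ 1)
    {ε : ℤ → ℝ} (hε : ∀ (k : ℤ) (x : ℝ), |∫ y in (k : ℝ)..(k + 1), u y * g (y - x)| ≤ ε k)
    (t : ℝ) : |∫ y, g y * u (t + y)|
      ≤ ∑ j ∈ Finset.range (2 * n + 1), ε (⌊t⌋ - n + j) := by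
  have hb : Integrable (fun y => u y * g (y - t)) :=
    (hg.comp_sub_right t).bdd_mul hu.aestronglyMeasurable (.of_forall hu1)
  set a : ℕ → ℝ := fun j => ((⌊t⌋ - n + j : ℤ) : ℝ) with ha
  have e1 : ∫ y, g y * u (t + y) = ∫ y, u y * g (y - t) := by
    rw [← integral_add_left_eq_self (fun y => u y * g (y - t)) t]
    congr 1
    ext y
    simp [mul_comm]
  -- The `2n + 1` unit intervals starting at `⌊t⌋ - n` cover `[t - n, t + n]`, outside which `g (y -
  -- t)` vanishes.
  have e2 : ∫ y, u y * g (y - t) = ∫ y in a 0..a (2 * n + 1), u y * g (y - t) := by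
    have hle : a 0 ≤ a (2 * n + 1) := by
      simp only [ha]; push_cast; nlinarith [(Nat.cast_nonneg n : (0 : ℝ) ≤ n)]
    rw [intervalIntegral.integral_of_le hle, ← integral_Icc_eq_integral_Ioc,
      setIntegral_eq_integral_of_forall_compl_eq_zero]
    intro y hy
    rw [hg0, mul_zero]
    contrapose! hy
    simp only [ha, Set.mem_Icc] at hy ⊢
    push_cast
    have := Int.floor_le t
    have := Int.lt_floor_add_one t
    constructor <;> linarith [hy.1, hy.2]
  rw [e1, e2, ← intervalIntegral.sum_integral_adjacent_intervals
    (fun j _ => hb.intervalIntegrable)]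
  refine (Finset.abs_sum_le_sum_abs _ _).trans (Finset.sum_le_sum fun j _ => ?_)
  have ha1 : a (j + 1) = a j + 1 := by simp only [ha]; push_cast; ring
  rw [ha1]
  exact hε _ t

theorem intervalIntegrable_integral_mul_translate {g u : ℝ → ℝ} (hg : Integrable g)
    (hu : Measurable u) {C : ℝ} (hC : ∀ y, ‖u y‖ ≤ C) (s s' : ℝ) :
    IntervalIntegrable (fun t => ∫ y, g y * u (t + y)) volume s s' := by
  refine IntervalIntegrable.mono_fun' (g := fun _ => ∫ y, ‖g y‖ * C) (by simp) ?_
    (.of_forall fun t => ?_)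
  · refine AEStronglyMeasurable.restrict ?_
    refine AEStronglyMeasurable.integral_prod_right'
      (f := fun p : ℝ × ℝ => g p.2 * u (p.1 + p.2)) ?_
    exact hg.1.comp_snd.mul
      (hu.comp (by fun_prop : Measurable fun p : ℝ × ℝ => p.1 + p.2)).aestronglyMeasurable
  · refine norm_integral_le_of_norm_le (hg.norm.mul_const C) (.of_forall fun y => ?_)
    rw [norm_mul]
    gcongr
    exact hC _

theorem arctan_sub_arctan_lower_bound {s s' : ℝ} (hs : s ≤ s') {n y : ℝ} (hy : |y| ≤ n) :
    ∫ t in s..s', (1 + (|t| + n) ^ 2)⁻¹ ≤ Real.arctan (s' + y) - Real.arctan (s + y) := by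
  have hcont : Continuous fun x : ℝ => (1 + x ^ 2)⁻¹ :=
    Continuous.inv₀ (by fun_prop) (fun x => by positivity)
  rw [← integral_inv_one_add_sq,
    ← intervalIntegral.integral_comp_add_right (fun x => (1 + x ^ 2)⁻¹) y]
  refine intervalIntegral.integral_mono_on hs
    ((hcont.comp (by fun_prop : Continuous fun t : ℝ => |t| + n)).intervalIntegrable _ _)
    ((hcont.comp (by fun_prop : Continuous fun t : ℝ => t + y)).intervalIntegrable _ _)
    fun t _ => ?_
  have h2 : (t + y) ^ 2 ≤ (|t| + n) ^ 2 := by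
    rw [← sq_abs (t + y)]
    gcongr
    exact (abs_add_le _ _).trans (by gcongr)
  gcongr

/-- A translate of a compactly supported measure on the line with integrable derivative can be
recovered from its measure on a single test set. -/
theorem exists_strictMono_translate {μ : Measure ℝ} [IsFiniteMeasure μ] (hμ : μ ≠ 0) {n : ℕ}
    (hsupp : μ (Set.Icc (-n : ℝ) n)ᶜ = 0) {g : ℝ → ℝ} (hg : Integrable g)
    (hg0 : ∀ y, y ∉ Set.Icc (-n : ℝ) n → g y = 0)
    (hFT : ∀ τ : ℝ, ∫ y : ℝ, Complex.exp (τ * y * Complex.I) * g y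
      = -(Complex.I * τ * charFun μ τ)) :
    ∃ S : Set ℝ, MeasurableSet S ∧ StrictMono fun t : ℝ => μ.real ((fun y => t + y) ⁻¹' S) := by
  set c : ℝ := μ.real Set.univ / Real.pi with hc
  have hμpos : 0 < μ.real Set.univ := by
    rw [measureReal_def, ENNReal.toReal_pos_iff]
    exact ⟨Measure.measure_univ_pos.2 hμ, measure_lt_top _ _⟩
  have hcpos : 0 < c := div_pos hμpos Real.pi_pos
  set h : ℝ → ℝ := fun y => 1 / 2 + Real.arctan y / Real.pi with hh
  have hm : Measurable h := by fun_prop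
  have h0 : ∀ y, 0 ≤ h y := fun y => by
    have : -(1 / 2) ≤ Real.arctan y / Real.pi := by
      rw [le_div_iff₀ Real.pi_pos]; linarith [Real.neg_pi_div_two_lt_arctan y]
    simp only [hh]; linarith
  have h1 : ∀ y, h y ≤ 1 := fun y => by
    have : Real.arctan y / Real.pi ≤ 1 / 2 := by
      rw [div_le_iff₀ Real.pi_pos]; linarith [Real.arctan_lt_pi_div_two y]
    simp only [hh]; linarith
  -- At most `2n + 1` intervals contribute at a given `t`, each with index `k` satisfying `|t - k| ≤
  -- n + 1`; this `ε` makes their total at most `c / 2 * w t`, half the guaranteed growth rate for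
  -- `h`.
  set ε : ℤ → ℝ := fun k => c / 2 / (2 * n + 1) * (1 + (|(k : ℝ)| + (2 * n + 1)) ^ 2)⁻¹ with hε
  obtain ⟨S, hS, hSε⟩ := exists_testSet_density hg hm h0 h1 (ε := ε) (fun k => by positivity)
  set v : ℝ → ℝ := S.indicator 1 with hv
  have hvm : Measurable v := measurable_one.indicator hS
  have hv0 : ∀ y, 0 ≤ v y := fun y => Set.indicator_nonneg (fun _ _ => zero_le_one) y
  have hv1 : ∀ y, v y ≤ 1 := fun y => Set.indicator_le_self' (fun _ _ => zero_le_one) y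
  have hvb : ∀ y, ‖v y‖ ≤ 1 := fun y => by rw [Real.norm_of_nonneg (hv0 y)]; exact hv1 y
  have hhb : ∀ y, ‖h y‖ ≤ 1 := fun y => by rw [Real.norm_of_nonneg (h0 y)]; exact h1 y
  have hum : Measurable fun y => v y - h y := hvm.sub hm
  have hub : ∀ y, ‖v y - h y‖ ≤ 1 := fun y => by
    rw [Real.norm_eq_abs, abs_le]
    constructor <;> linarith [h0 y, h1 y, hv0 y, hv1 y]
  set w : ℝ → ℝ := fun t => (1 + (|t| + n) ^ 2)⁻¹ with hw
  have hwc : Continuous w := Continuous.inv₀ (by fun_prop) (fun x => by positivity)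
  have hsmall : ∀ t, |∫ y, g y * (v (t + y) - h (t + y))| ≤ c / 2 * w t := by
    intro t
    refine (abs_integral_mul_translate_le_sum hg hg0 hum hub hSε t).trans ?_
    have hj : ∀ j ∈ Finset.range (2 * n + 1), ε (⌊t⌋ - n + j) ≤ c / 2 / (2 * n + 1) * w t := by
      intro j hj
      have hj' : (j : ℝ) ≤ 2 * n := by
        exact_mod_cast Nat.lt_succ_iff.1 (Finset.mem_range.1 hj)
      have hj0 : (0 : ℝ) ≤ j := Nat.cast_nonneg j
      have f1 := Int.floor_le t
      have f2 := Int.lt_floor_add_one t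
      have hle : |t| + n ≤ |((⌊t⌋ - n + j : ℤ) : ℝ)| + (2 * n + 1) := by
        have h3 : |t - ((⌊t⌋ - n + j : ℤ) : ℝ)| ≤ n + 1 := by
          push_cast
          rw [abs_le]
          constructor <;> linarith
        have := abs_sub_abs_le_abs_sub t ((⌊t⌋ - n + j : ℤ) : ℝ)
        linarith
      simp only [hε, hw]
      gcongr
    refine (Finset.sum_le_sum hj).trans ?_
    rw [Finset.sum_const, Finset.card_range, nsmul_eq_mul]
    push_cast
    exact le_of_eq (by field_simp)
  refine ⟨S, hS, fun s s' hss => ?_⟩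
  have hreal (t : ℝ) : μ.real ((fun y => t + y) ⁻¹' S) = ∫ y, v (t + y) ∂μ := by
    rw [← integral_indicator_one (hS.preimage (by fun_prop))]
    rfl
  have hdv := integral_translate_sub hg hFT hss.le hvm hvb
  have hdh := integral_translate_sub hg hFT hss.le hm hhb
  have hsplit : ∫ t in s..s', ∫ y, g y * v (t + y)
      = (∫ t in s..s', ∫ y, g y * h (t + y))
        + ∫ t in s..s', ∫ y, g y * (v (t + y) - h (t + y)) := by
    rw [← intervalIntegral.integral_add
      (intervalIntegrable_integral_mul_translate hg hm hhb s s')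
      (intervalIntegrable_integral_mul_translate hg hum hub s s')]
    congr 1
    ext t
    rw [← integral_add]
    · congr 1
      ext y
      ring
    · exact hg.mul_bdd (hm.comp (measurable_const_add t)).aestronglyMeasurable (.of_forall fun y => hhb _)
    · exact hg.mul_bdd (hum.comp (measurable_const_add t)).aestronglyMeasurable (.of_forall fun y => hub _)
  have hE : |∫ t in s..s', ∫ y, g y * (v (t + y) - h (t + y))| ≤ c / 2 * ∫ t in s..s', w t := by
    rw [← intervalIntegral.integral_const_mul]
    rw [← Real.norm_eq_abs]
    refine intervalIntegral.norm_integral_le_of_norm_le hss.le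
      (.of_forall fun t _ => (Real.norm_eq_abs _).trans_le (hsmall t))
      ((hwc.intervalIntegrable _ _).const_mul _)
  have hwpos : 0 < ∫ t in s..s', w t :=
    intervalIntegral.intervalIntegral_pos_of_pos (hwc.intervalIntegrable _ _)
      (fun t => by positivity) hss
  -- On the support of `μ` one has `|t + y| ≤ |t| + n`, so the derivative of `arctan` at `t + y` is
  -- at least `w t`.
  have hmain : c * ∫ t in s..s', w t ≤ ∫ y, h (s' + y) ∂μ - ∫ y, h (s + y) ∂μ := by
    have hint (t : ℝ) : Integrable (fun y => h (t + y)) μ :=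
      (integrable_const (1 : ℝ)).mono' (hm.comp (by fun_prop)).aestronglyMeasurable
        (.of_forall fun y => hhb _)
    rw [← integral_sub (hint s') (hint s)]
    have e : c * ∫ t in s..s', w t = ∫ _, (∫ t in s..s', w t) / Real.pi ∂μ := by
      rw [integral_const, smul_eq_mul, hc]
      ring
    rw [e]
    refine integral_mono_ae (integrable_const _) ((hint s').sub (hint s)) ?_
    have hae : ∀ᵐ y ∂μ, y ∈ Set.Icc (-n : ℝ) n := by
      rw [ae_iff]; exact hsupp
    filter_upwards [hae] with y hy
    have := arctan_sub_arctan_lower_bound hss.le (abs_le.2 hy)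
    have e2 : h (s' + y) - h (s + y)
        = (Real.arctan (s' + y) - Real.arctan (s + y)) / Real.pi := by
      simp only [hh]; ring
    rw [e2]
    exact div_le_div_of_nonneg_right this Real.pi_pos.le
  simp only [hreal]
  have := (abs_le.1 hE).2
  have := mul_pos hcpos hwpos
  linarith

end TranslateMeasureOnLine

/-! ### Decay of the characteristic function along almost every ray -/

section Directions

variable {V : Type*} [NormedAddCommGroup V] [InnerProductSpace ℝ V] [FiniteDimensional ℝ V]
  [MeasurableSpace V] [BorelSpace V]

theorem lintegral_inv_indicator_le_one (ρ : ℝ) :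
    ∫⁻ r in Set.Ioi (1 : ℝ), {r : ℝ | r < ρ ∧ ρ < 2 * r}.indicator
      (fun r => ENNReal.ofReal r⁻¹) r ≤ 1 := by
  have hset : {r : ℝ | r < ρ ∧ ρ < 2 * r} = Set.Ioo (ρ / 2) ρ := by
    ext r
    simp only [Set.mem_ofPred_eq, Set.mem_Ioo]
    constructor <;> rintro ⟨h1, h2⟩ <;> constructor <;> linarith
  rw [hset]
  refine (setLIntegral_le_lintegral _ _).trans ?_
  rw [lintegral_indicator measurableSet_Ioo]
  rcases le_or_gt ρ 0 with hρ | hρ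
  · rw [Set.Ioo_eq_empty (by linarith)]
    simp
  calc ∫⁻ r in Set.Ioo (ρ / 2) ρ, ENNReal.ofReal r⁻¹
      ≤ ∫⁻ _ in Set.Ioo (ρ / 2) ρ, ENNReal.ofReal (ρ / 2)⁻¹ := by
        refine setLIntegral_mono measurable_const fun r hr => ?_
        exact ENNReal.ofReal_le_ofReal (inv_anti₀ (by positivity) hr.1.le)
    _ = 1 := by
        rw [setLIntegral_const, Real.volume_Ioo, ← ENNReal.ofReal_mul (by positivity)]
        rw [show (ρ / 2)⁻¹ * (ρ - ρ / 2) = 1 by field_simp; ring]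
        simp

/-- The substitution `η = r • θ` costs `r ^ (-d)`, and `r ^ 2 * r ^ (-d) ≤ r⁻¹` for `r > 1`: this is
where dimension at least three enters. -/
theorem lintegral_shell_comp_smul_le (h3 : 3 ≤ Module.finrank ℝ V) {f : V → ENNReal}
    (hf : Measurable f) {r : ℝ} (hr : 1 < r) :
    ENNReal.ofReal (r ^ 2) * ∫⁻ θ in {θ : V | 1 < ‖θ‖ ∧ ‖θ‖ < 2}, f (r • θ)
      ≤ ENNReal.ofReal r⁻¹ * ∫⁻ η in {η : V | r < ‖η‖ ∧ ‖η‖ < 2 * r}, f η := by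
  have hr0 : 0 < r := by linarith
  have m1 (a b : ℝ) : MeasurableSet {η : V | a < ‖η‖ ∧ ‖η‖ < b} :=
    (measurableSet_lt measurable_const measurable_norm).inter
      (measurableSet_lt measurable_norm measurable_const)
  have e1 : ∫⁻ θ in {θ : V | 1 < ‖θ‖ ∧ ‖θ‖ < 2}, f (r • θ)
      = ∫⁻ θ, {η : V | r < ‖η‖ ∧ ‖η‖ < 2 * r}.indicator f (r • θ) := by
    rw [← lintegral_indicator (m1 1 2)]
    congr 1
    ext θ
    have : r • θ ∈ {η : V | r < ‖η‖ ∧ ‖η‖ < 2 * r} ↔ θ ∈ {θ : V | 1 < ‖θ‖ ∧ ‖θ‖ < 2} := by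
      simp only [Set.mem_ofPred_eq, norm_smul, Real.norm_of_nonneg hr0.le]
      rw [lt_mul_iff_one_lt_right hr0, mul_comm 2 r, mul_lt_mul_iff_right₀ hr0]
    by_cases hθ : θ ∈ {θ : V | 1 < ‖θ‖ ∧ ‖θ‖ < 2}
    · rw [Set.indicator_of_mem hθ, Set.indicator_of_mem (this.2 hθ)]
    · rw [Set.indicator_of_notMem hθ, Set.indicator_of_notMem (mt this.1 hθ)]
  rw [e1, ← lintegral_map (hf.indicator (m1 _ _)) (measurable_const_smul r),
    Measure.map_addHaar_smul _ hr0.ne', lintegral_smul_measure, smul_eq_mul, ← mul_assoc,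
    ← ENNReal.ofReal_mul (by positivity), lintegral_indicator (m1 _ _)]
  gcongr
  rw [abs_of_pos (by positivity)]
  have : r ^ 3 ≤ r ^ Module.finrank ℝ V := pow_le_pow_right₀ hr.le h3
  calc r ^ 2 * (r ^ Module.finrank ℝ V)⁻¹ ≤ r ^ 2 * (r ^ 3)⁻¹ := by gcongr
    _ = r⁻¹ := by field_simp

/-- Tonelli over a solid shell of directions replaces polar coordinates: each `η` is met only for
`r` in `(‖η‖ / 2, ‖η‖)`, an interval of `dr / r`-mass at most one. -/
theorem ae_lintegral_ray_lt_top (h3 : 3 ≤ Module.finrank ℝ V) {f : V → ENNReal}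
    (hf : Measurable f) (hfin : ∫⁻ η, f η < ⊤) :
    ∀ᵐ θ ∂(volume : Measure V).restrict {θ : V | 1 < ‖θ‖ ∧ ‖θ‖ < 2},
      ∫⁻ r in Set.Ioi (1 : ℝ), ENNReal.ofReal (r ^ 2) * f (r • θ) < ⊤ := by
  have m1 (a b : ℝ) : MeasurableSet {η : V | a < ‖η‖ ∧ ‖η‖ < b} :=
    (measurableSet_lt measurable_const measurable_norm).inter
      (measurableSet_lt measurable_norm measurable_const)
  have hmeas : Measurable fun p : V × ℝ => ENNReal.ofReal (p.2 ^ 2) * f (p.2 • p.1) :=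
    (by fun_prop : Measurable fun p : V × ℝ => ENNReal.ofReal (p.2 ^ 2)).mul
      (hf.comp (by fun_prop))
  refine ae_lt_top hmeas.lintegral_prod_right' ?_
  refine ne_top_of_le_ne_top hfin.ne ?_
  rw [lintegral_lintegral_swap hmeas.aemeasurable]
  have hk : MeasurableSet {p : ℝ × V | p.1 < ‖p.2‖ ∧ ‖p.2‖ < 2 * p.1} :=
    (measurableSet_lt measurable_fst measurable_snd.norm).inter
      (measurableSet_lt measurable_snd.norm (measurable_fst.const_mul 2))
  calc ∫⁻ r in Set.Ioi (1 : ℝ), ∫⁻ θ in {θ : V | 1 < ‖θ‖ ∧ ‖θ‖ < 2},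
        ENNReal.ofReal (r ^ 2) * f (r • θ)
      ≤ ∫⁻ r in Set.Ioi (1 : ℝ), ∫⁻ η, {p : ℝ × V | p.1 < ‖p.2‖ ∧ ‖p.2‖ < 2 * p.1}.indicator
          (fun p => ENNReal.ofReal p.1⁻¹ * f p.2) (r, η) := by
        refine setLIntegral_mono_ae' measurableSet_Ioi (.of_forall fun r hr => ?_)
        rw [lintegral_const_mul (f := fun θ => f (r • θ)) _ (hf.comp (measurable_const_smul r))]
        refine (lintegral_shell_comp_smul_le h3 hf hr).trans_eq ?_
        rw [← lintegral_const_mul _ hf, ← lintegral_indicator (m1 _ _)]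
        rfl
    _ = ∫⁻ η, ∫⁻ r in Set.Ioi (1 : ℝ), {p : ℝ × V | p.1 < ‖p.2‖ ∧ ‖p.2‖ < 2 * p.1}.indicator
          (fun p => ENNReal.ofReal p.1⁻¹ * f p.2) (r, η) := by
        refine lintegral_lintegral_swap ?_
        refine Measurable.aemeasurable (Measurable.indicator ?_ hk)
        exact (by fun_prop : Measurable fun p : ℝ × V => ENNReal.ofReal p.1⁻¹).mul
          (hf.comp measurable_snd)
    _ ≤ ∫⁻ η, f η := by
        refine lintegral_mono fun η => ?_
        have e (r : ℝ) : {p : ℝ × V | p.1 < ‖p.2‖ ∧ ‖p.2‖ < 2 * p.1}.indicator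
            (fun p => ENNReal.ofReal p.1⁻¹ * f p.2) (r, η)
            = {r : ℝ | r < ‖η‖ ∧ ‖η‖ < 2 * r}.indicator (fun r => ENNReal.ofReal r⁻¹) r * f η := by
          by_cases hr : r < ‖η‖ ∧ ‖η‖ < 2 * r <;> simp [Set.indicator, hr]
        have ms : MeasurableSet {r : ℝ | r < ‖η‖ ∧ ‖η‖ < 2 * r} :=
          (measurableSet_lt measurable_id measurable_const).inter
            (measurableSet_lt measurable_const (measurable_id.const_mul 2))
        simp only [e]
        rw [lintegral_mul_const _ (Measurable.indicator (by fun_prop) ms)]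
        exact mul_le_of_le_one_left zero_le (lintegral_inv_indicator_le_one _)

theorem charFun_map_inner (ν : Measure V) (θ : V) (r : ℝ) :
    charFun (ν.map fun y => ⟪y, θ⟫) r = charFun ν (r • θ) := by
  rw [charFun_apply_real, charFun_apply, integral_map (by fun_prop) (by fun_prop)]
  simp [inner_smul_right]

/-- The negative ray follows by conjugation symmetry, and on `[-1, 1]` the function is bounded. -/
theorem memLp_two_mul_charFun_of_ray {μ : Measure ℝ} [IsFiniteMeasure μ]
    (h : ∫⁻ r in Set.Ioi (1 : ℝ), ENNReal.ofReal (r ^ 2) * ‖charFun μ r‖ₑ ^ 2 < ⊤) :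
    MemLp (fun τ : ℝ => (τ : ℂ) * charFun μ τ) 2 := by
  have hm : Measurable fun τ : ℝ => (τ : ℂ) * charFun μ τ := by fun_prop
  have hsq (τ : ℝ) : ‖(τ : ℂ) * charFun μ τ‖ₑ ^ 2
      = ENNReal.ofReal (τ ^ 2) * ‖charFun μ τ‖ₑ ^ 2 := by
    rw [enorm_mul, mul_pow]
    congr 1
    rw [← ofReal_norm, ← ENNReal.ofReal_pow (norm_nonneg _)]
    simp
  have h1 : ∫⁻ τ in Set.Ioi (1 : ℝ), ‖(τ : ℂ) * charFun μ τ‖ₑ ^ 2 < ⊤ := by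
    simpa only [hsq] using h
  have h2 : ∫⁻ τ in Set.Iio (-1 : ℝ), ‖(τ : ℂ) * charFun μ τ‖ₑ ^ 2 < ⊤ := by
    have := (Measure.measurePreserving_neg (volume : Measure ℝ)).setLIntegral_comp_preimage
      (measurableSet_Ioi (a := (1 : ℝ))) (hm.enorm.pow_const 2)
    rw [← this] at h1
    convert h1 using 2
    · congr 1
      ext x
      simp [lt_neg]
    · ext τ
      simp [charFun_neg, enorm_mul]
  have h3 : ∫⁻ τ in Set.Icc (-1 : ℝ) 1, ‖(τ : ℂ) * charFun μ τ‖ₑ ^ 2 < ⊤ := by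
    refine lt_of_le_of_lt (setLIntegral_mono (g := fun _ => ENNReal.ofReal
      (1 * μ.real Set.univ) ^ 2) measurable_const fun τ hτ => ?_) ?_
    · rw [← ofReal_norm]
      gcongr
      rw [norm_mul]
      gcongr
      · simpa using abs_le.2 hτ
      · exact norm_charFun_le τ
    · rw [setLIntegral_const]
      exact ENNReal.mul_lt_top (by finiteness) (by simp)
  have huniv : (Set.univ : Set ℝ) = (Set.Iio (-1) ∪ Set.Icc (-1) 1) ∪ Set.Ioi 1 := by
    rw [Set.Iio_union_Icc_eq_Iic (by norm_num), Set.Iic_union_Ioi]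
  have htot : ∫⁻ τ : ℝ, ‖(τ : ℂ) * charFun μ τ‖ₑ ^ 2 < ⊤ := by
    rw [← setLIntegral_univ, huniv]
    refine (lintegral_union_le _ _ _).trans_lt (ENNReal.add_lt_top.2 ⟨?_, h1⟩)
    exact (lintegral_union_le _ _ _).trans_lt (ENNReal.add_lt_top.2 ⟨h2, h3⟩)
  refine ⟨hm.aestronglyMeasurable, ?_⟩
  rw [eLpNorm_lt_top_iff_lintegral_rpow_enorm_lt_top (by norm_num) (by norm_num)]
  simpa using htot

end Directions

/-! ### Spanning directions and cylindrical test sets -/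

section Reconstruction

/-- A proper subspace is null, so it cannot contain almost all of a nonempty open set. -/
theorem exists_spanning_of_ae {V : Type*} [NormedAddCommGroup V] [InnerProductSpace ℝ V]
    [FiniteDimensional ℝ V] [MeasurableSpace V] [BorelSpace V] {U : Set V} (hU : IsOpen U)
    (hne : U.Nonempty) {p : V → Prop}
    (hp : ∀ᵐ θ ∂(volume : Measure V).restrict U, p θ) :
    ∃ θ : Fin (Module.finrank ℝ V) → V, (∀ i, θ i ∈ U ∧ p (θ i)) ∧
      Submodule.span ℝ (Set.range θ) = ⊤ := by
  have hspan : Submodule.span ℝ {θ | θ ∈ U ∧ p θ} = ⊤ := by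
    by_contra hne'
    have h0 := Measure.addHaar_submodule volume _ hne'
    have h1 : ∀ᵐ θ ∂(volume : Measure V).restrict U, False := by
      filter_upwards [hp, ae_restrict_mem hU.measurableSet,
        ae_restrict_of_ae (measure_eq_zero_iff_ae_notMem.1 h0)] with θ h1 h2 h3
      exact h3 (Submodule.subset_span ⟨h2, h1⟩)
    have h2 : volume U = 0 := by
      simpa using h1
    exact (hU.measure_pos volume hne).ne' h2
  obtain ⟨f, hf, hf', -⟩ := Submodule.exists_fun_fin_finrank_span_eq ℝ {θ | θ ∈ U ∧ p θ}
  have hd : Module.finrank ℝ (Submodule.span ℝ {θ | θ ∈ U ∧ p θ}) = Module.finrank ℝ V := by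
    rw [hspan, finrank_top]
  refine ⟨f ∘ finCongr hd.symm, fun i => hf _, ?_⟩
  rw [(finCongr hd.symm).surjective.range_comp, hf', hspan]

theorem volume_translateSet_inter {d : ℕ} (E T : Set (EuclideanSpace ℝ (Fin d)))
    (x : EuclideanSpace ℝ (Fin d)) :
    volume (translateSet E x ∩ T) = volume (E ∩ (fun y => y + x) ⁻¹' T) := by
  rw [← measure_preimage_add_right volume x (translateSet E x ∩ T), Set.preimage_inter,
    translateSet, Set.preimage_image_eq E (add_left_injective x)]

/-- Almost every direction admits a cylindrical test set whose intersection with a translate of `E`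
determines the component of the translation in that direction. -/
theorem exists_strictMono_cylinder {V : Type*} [NormedAddCommGroup V] [InnerProductSpace ℝ V]
    [FiniteDimensional ℝ V] [MeasurableSpace V] [BorelSpace V] {E : Set V}
    (hE : Bornology.IsBounded E) (hpos : volume E ≠ 0) {θ : V}
    (hθ : ∫⁻ r in Set.Ioi (1 : ℝ),
      ENNReal.ofReal (r ^ 2) * ‖charFun (volume.restrict E) (r • θ)‖ₑ ^ 2 < ⊤) :
    ∃ S : Set ℝ, MeasurableSet S ∧
      StrictMono fun t : ℝ => volume.real (E ∩ (fun y => t + ⟪y, θ⟫) ⁻¹' S) := by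
  have hfin : volume E < ⊤ := hE.measure_lt_top
  have : IsFiniteMeasure (volume.restrict E) := ⟨by simpa using hfin⟩
  set μ : Measure ℝ := (volume.restrict E).map fun y => ⟪y, θ⟫ with hμ
  have hmeas : Measurable fun y : V => ⟪y, θ⟫ := by fun_prop
  have hμ0 : μ ≠ 0 := by
    rw [hμ, Ne, Measure.map_eq_zero_iff hmeas.aemeasurable, Measure.restrict_eq_zero]
    exact hpos
  obtain ⟨R, hR⟩ := hE.exists_norm_le
  obtain ⟨n, hn⟩ := exists_nat_ge (R * ‖θ‖)
  have hsupp : μ (Set.Icc (-n : ℝ) n)ᶜ = 0 := by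
    rw [hμ, Measure.map_apply hmeas measurableSet_Icc.compl,
      Measure.restrict_apply (hmeas measurableSet_Icc.compl)]
    convert measure_empty (μ := (volume : Measure V))
    rw [Set.eq_empty_iff_forall_notMem]
    rintro y ⟨hy, hyE⟩
    refine hy (abs_le.1 ((abs_real_inner_le_norm _ _).trans (le_trans ?_ hn)))
    gcongr
    exact hR y hyE
  have h2 : MemLp (fun τ : ℝ => (τ : ℂ) * charFun μ τ) 2 := by
    refine memLp_two_mul_charFun_of_ray ?_
    simpa only [hμ, charFun_map_inner] using hθ
  obtain ⟨g, hg, hg0, hFT⟩ := exists_integrable_weak_deriv hsupp h2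
  obtain ⟨S, hS, hmono⟩ := exists_strictMono_translate hμ0 hsupp hg hg0 hFT
  refine ⟨S, hS, ?_⟩
  convert hmono using 2 with t
  have hS' : MeasurableSet ((fun y => t + y) ⁻¹' S) := hS.preimage (by fun_prop)
  rw [hμ, map_measureReal_apply hmeas hS', measureReal_restrict_apply (hmeas hS'), Set.inter_comm]
  rfl

theorem exists_testSets_translates {d : ℕ} (hd : 3 ≤ d) {E : Set (EuclideanSpace ℝ (Fin d))}
    (hE_meas : NullMeasurableSet E volume) (hE_bdd : Bornology.IsBounded E)
    (hE_pos : 0 < volume E) :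
    ∃ T : Fin d → Set (EuclideanSpace ℝ (Fin d)), (∀ i, MeasurableSet (T i)) ∧
      ∀ x x' : EuclideanSpace ℝ (Fin d),
        (∀ i, volume (translateSet E x ∩ T i) = volume (translateSet E x' ∩ T i)) → x = x' := by
  have hfin : volume E < ⊤ := hE_bdd.measure_lt_top
  have : IsFiniteMeasure (volume.restrict E) := ⟨by simpa using hfin⟩
  have hrank : Module.finrank ℝ (EuclideanSpace ℝ (Fin d)) = d := by simp
  have hopen : IsOpen {θ : EuclideanSpace ℝ (Fin d) | 1 < ‖θ‖ ∧ ‖θ‖ < 2} :=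
    (isOpen_lt continuous_const continuous_norm).inter
      (isOpen_lt continuous_norm continuous_const)
  have hne : {θ : EuclideanSpace ℝ (Fin d) | 1 < ‖θ‖ ∧ ‖θ‖ < 2}.Nonempty := by
    refine ⟨EuclideanSpace.single ⟨0, by lia⟩ (3 / 2 : ℝ), ?_⟩
    simp only [Set.mem_ofPred_eq, PiLp.norm_single]
    norm_num
  have hae := ae_lintegral_ray_lt_top (V := EuclideanSpace ℝ (Fin d)) (by rwa [hrank])
    (f := fun ξ => ‖charFun (volume.restrict E) ξ‖ₑ ^ 2)
    (by fun_prop) (lintegral_charFun_restrict_sq_lt_top hE_meas hfin.ne)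
  obtain ⟨θ, hθ, hspan⟩ := exists_spanning_of_ae hopen hne hae
  choose S hS hmono using fun i => exists_strictMono_cylinder hE_bdd hE_pos.ne' (hθ i).2
  refine ⟨fun i => (fun y => ⟪y, θ (finCongr hrank.symm i)⟫) ⁻¹' S (finCongr hrank.symm i),
    fun i => (hS _).preimage (by fun_prop), fun x x' hxx => ?_⟩
  -- Cutting `E + x` with the `j`-th cylinder gives the strictly monotone function of that direction
  -- evaluated at `⟪x, θ j⟫`.
  have hinner : ∀ j, ⟪x, θ j⟫ = ⟪x', θ j⟫ := by
    intro j
    refine (hmono j).injective ?_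
    have h := congrArg ENNReal.toReal (hxx (finCongr hrank j))
    rw [volume_translateSet_inter, volume_translateSet_inter] at h
    simpa [Measure.real, Set.preimage_preimage, inner_add_left, add_comm] using h
  refine ext_inner_right ℝ fun v => ?_
  have hv : v ∈ Submodule.span ℝ (Set.range θ) := hspan ▸ Submodule.mem_top
  induction hv using Submodule.span_induction with
  | mem v hv => obtain ⟨j, rfl⟩ := hv; exact hinner j
  | zero => simp
  | add a b _ _ ha hb => rw [inner_add_right, inner_add_right, ha, hb]
  | smul c a _ ha => rw [inner_smul_right, inner_smul_right, ha]

end Reconstruction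

theorem corollaryc (d : ℕ) (hd : 3 ≤ d) (E : Set (EuclideanSpace ℝ (Fin d)))
    (hE_meas : NullMeasurableSet E volume) (hE_bdd : Bornology.IsBounded E)
    (hE_pos : 0 < volume E) :
    CanBeReconstructed (Set.range (translateSet E)) d ∧
    ∃ T : Fin d → Set (EuclideanSpace ℝ (Fin d)),
      (∀ i, MeasurableSet (T i)) ∧
      ∀ x x' : EuclideanSpace ℝ (Fin d), x ≠ x' →
        ∃ i, volume (translateSet E x ∩ T i) ≠ volume (translateSet E x' ∩ T i) := by
  obtain ⟨T, hT, hinj⟩ := exists_testSets_translates hd hE_meas hE_bdd hE_pos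
  refine ⟨⟨?_, T, fun i => (hT i).nullMeasurableSet, ?_⟩, T, hT, fun x x' hne => ?_⟩
  · rintro _ ⟨x, rfl⟩
    have e : translateSet E x = (fun y => y + -x) ⁻¹' E := Set.image_add_right
    rw [e]
    refine ⟨hE_meas.preimage (measurePreserving_add_right volume (-x)).quasiMeasurePreserving, ?_⟩
    rw [measure_preimage_add_right]
    exact hE_bdd.measure_lt_top
  · rintro _ ⟨x, rfl⟩ _ ⟨x', rfl⟩ h
    rw [hinj x x' h]
  · by_contra! h
    exact hne (hinj x x' h)
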